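/- Let $p$ be a prime number, let $n\ge 2$ be an integer, let $F$ be a free pro-$p$ group on finitely many generators $x_1,\dots,x_d$, let $R$ be a closed normal subgroup of $F$ with $R\subseteq F^p[F,F]$, and let $G=F/R$. Let $F_{(m)}$ ($m\ge 1$) denote the Zassenhaus filtration of $F$, i.e. $F_{(m)}=\{f\in F : f-1\in I^m\}$, where $I$ is the augmentation ideal of the completed group algebra $\mathbb F_p[[F]]$. Cohomology is continuous cohomology with trivial coefficients. For $\chi_1,\dots,\chi_k\in H^1(G,\mathbb Z/p)=\mathrm{Hom}(G,\mathbb Z/p)$, $k\ge 2$, a defining system is a family of continuous $1$-cochains $a_{ij}:G\to\mathbb Z/p$ ($1\le i<j\le k+1$, $(i,j)\ne(1,k+1)$) with $a_{i,i+1}=\chi_i$ and $\partial a_{ij}=\sum_{i<l<j}a_{il}\cup a_{lj}$. The Massey product $\langle\chi_1,\dots,\chi_k\rangle\subseteq H^2(G,\mathbb Z/p)$ is the set of the classes of the cocycles $\sum_{1<l<k+1}a_{1l}\cup a_{l,k+1}$ attached to all defining systems. It is defined if it is nonempty, it vanishes if it contains $0$, it is uniquely defined if it has exactly one element, and it is strictly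 defined if it is defined and $\langle\chi_i,\dots,\chi_j\rangle=\{0\}$ for every $i<j$ with $(i,j)\neq(1,k)$. The group $G$ has the $k$-fold Massey vanishing property if every $k$-fold Massey product that is defined vanishes. For $k\ge 3$ it has the strong $k$-fold Massey vanishing property if $\langle\chi_1,\dots,\chi_k\rangle$ vanishes whenever $\chi_1\cup\chi_2=\chi_2\cup\chi_3=\dots=\chi_{k-1}\cup\chi_k=0$; for $k=2$ both properties mean that $\chi_1\cup\chi_2=0$ for all $\chi_1,\chi_2\in H^1(G,\mathbb Z/p)$. The following are equivalent: (i) $R\subseteq F_{(n+1)}$; (ii) for all $2\le k\le n$, all $k$-fold Massey products $\langle\chi_1,\dots,\chi_k\rangle$ with $\chi_1,\dots,\chi_k\in H^1(G,\mathbb Z/p)$ are strictly and uniquely defined and equal to $0$; (iii) $G$ has the strong $k$-fold Massey vanishing property for all $2\le k\le n$; (iv) $G$ has the $k$-fold Massey vanishing property for all $2\le k\le n$. -/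

import Mathlib

/-! ### Pro-`p` groups, free pro-`p` groups, the Zassenhaus filtration -/

namespace ProPMassey

/-- A topological group is pro-`p` if it is profinite and every quotient by an open normal
subgroup is a `p`-group. -/
structure IsProP (p : ℕ) (G : Type*) [Group G] [TopologicalSpace G] : Prop where
  isTopologicalGroup : IsTopologicalGroup G
  compact : CompactSpace G
  t2 : T2Space G
  totallyDisconnected : TotallyDisconnectedSpace G
  isPGroup : ∀ N : OpenNormalSubgroup G, IsPGroup p (G ⧸ N.toSubgroup)

/-- `F` is a free pro-`p` group on the finite family `x`: `F` is pro-`p`, and every map from the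
family to a finite `p`-group `P` (with the discrete topology) extends uniquely to a continuous
homomorphism `F → P`. -/
structure IsFreeProP (p : ℕ) {F : Type*} [Group F] [TopologicalSpace F] {d : ℕ}
    (x : Fin d → F) : Prop where
  isProP : IsProP p F
  existsUnique_lift : ∀ (P : Type) [Group P] [Finite P] [TopologicalSpace P]
    [DiscreteTopology P], IsPGroup p P → ∀ y : Fin d → P, ∃! φ : F →ₜ* P, ∀ i, φ (x i) = y i

/-- The closed subgroup `F^p [F, F]`, topologically generated by all `p`-th powers and all
commutators. -/
def powerCommutatorSubgroup (p : ℕ) (F : Type*) [Group F] [TopologicalSpace F]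
    [IsTopologicalGroup F] : Subgroup F :=
  (Subgroup.closure (Set.range fun g : F => g ^ p) ⊔ commutator F).topologicalClosure

/-- The augmentation ideal of the group algebra `𝔽_p[H]`: the kernel of the algebra homomorphism
`𝔽_p[H] → 𝔽_p` that sends every group element to `1`. -/
noncomputable def augmentationIdeal (p : ℕ) (H : Type*) [Group H] :
    Ideal (MonoidAlgebra (ZMod p) H) :=
  RingHom.ker (MonoidAlgebra.lift (ZMod p) (ZMod p) H 1)

/-- The `n`-th term `G_(n)` of the Zassenhaus filtration of a profinite group `G`: the elements
`g` such that `g - 1` lies in the `n`-th (closed) power of the augmentation ideal of the completed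
group algebra `𝔽_p[[G]] = lim 𝔽_p[G/N]`. By definition of the inverse limit topology this means
that, for every open normal subgroup `N`, the element `gN - 1` of `𝔽_p[G/N]` lies in the `n`-th
power of the augmentation ideal of `𝔽_p[G/N]`. -/
noncomputable def zassenhaus (p : ℕ) (G : Type*) [Group G] [TopologicalSpace G] (n : ℕ) :
    Subgroup G where
  carrier := {g | ∀ N : OpenNormalSubgroup G,
    MonoidAlgebra.of (ZMod p) (G ⧸ N.toSubgroup) (QuotientGroup.mk g) - 1 ∈
      augmentationIdeal p (G ⧸ N.toSubgroup) ^ n}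
  one_mem' := by
    intro N
    rw [QuotientGroup.mk_one, map_one, sub_self]
    exact zero_mem _
  mul_mem' := by
    intro g h hg hh N
    have key := Ideal.add_mem _
      (Ideal.mul_mem_left _ (MonoidAlgebra.of (ZMod p) (G ⧸ N.toSubgroup) (QuotientGroup.mk g))
        (hh N)) (hg N)
    rw [mul_sub, mul_one, sub_add_sub_cancel, ← map_mul, ← QuotientGroup.mk_mul] at key
    exact key
  inv_mem' := by
    intro g hg N
    have key := neg_mem (Ideal.mul_mem_left _
      (MonoidAlgebra.of (ZMod p) (G ⧸ N.toSubgroup) (QuotientGroup.mk g⁻¹)) (hg N))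
    rw [mul_sub, mul_one, ← map_mul, ← QuotientGroup.mk_mul, inv_mul_cancel, QuotientGroup.mk_one,
      map_one, neg_sub] at key
    exact key

/-! ### Continuous cochains with coefficients in `ℤ/p` (trivial action) -/

section Cochains

variable (p : ℕ) (G : Type*) [Group G] [TopologicalSpace G] [IsTopologicalGroup G]

/-- The coboundary `C¹ → C²` of inhomogeneous continuous cochains,
`(∂a)(g, h) = a(h) - a(gh) + a(g)`. -/
def d1 : C(G, ZMod p) →+ C(G × G, ZMod p) where
  toFun a := ⟨fun x => a x.2 - a (x.1 * x.2) + a x.1, by fun_prop⟩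
  map_zero' := by ext; simp
  map_add' a b := by ext; simp; ring

/-- The coboundary `C² → C³` of inhomogeneous continuous cochains,
`(∂b)(g, h, k) = b(h, k) - b(gh, k) + b(g, hk) - b(g, h)`. -/
def d2 : C(G × G, ZMod p) →+ C(G × G × G, ZMod p) where
  toFun b := ⟨fun x => b (x.2.1, x.2.2) - b (x.1 * x.2.1, x.2.2) + b (x.1, x.2.1 * x.2.2)
    - b (x.1, x.2.1), by fun_prop⟩
  map_zero' := by ext; simp
  map_add' a b := by ext; simp; ring

/-- `H¹(G, ℤ/p)`: the group of continuous homomorphisms `G → ℤ/p`, realized as the group of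
continuous `1`-cocycles (the `1`-coboundaries are zero, since the action is trivial). -/
abbrev H1 : AddSubgroup C(G, ZMod p) := (d1 p G).ker

/-- The continuous `2`-cocycles. -/
abbrev Z2 : AddSubgroup C(G × G, ZMod p) := (d2 p G).ker

/-- `H²(G, ℤ/p)`: continuous `2`-cocycles modulo `2`-coboundaries. -/
abbrev H2 : Type _ := Z2 p G ⧸ (d1 p G).range.addSubgroupOf (Z2 p G)

variable {p G}

/-- The cup product of two `1`-cochains, `(a ∪ b)(g, h) = a(g) b(h)`. -/
def cup (a b : C(G, ZMod p)) : C(G × G, ZMod p) :=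
  ⟨fun x => a x.1 * b x.2, by fun_prop⟩

theorem d2_cup_apply (a b : C(G, ZMod p)) (g h k : G) :
    d2 p G (cup a b) (g, h, k) = d1 p G a (g, h) * b k - a g * d1 p G b (h, k) := by
  simp only [d2, d1, cup, AddMonoidHom.coe_mk, ZeroHom.coe_mk, ContinuousMap.coe_mk]
  ring

theorem cup_mem_Z2 (χ ψ : H1 p G) : cup χ.1 ψ.1 ∈ Z2 p G := by
  have h1 : d1 p G χ.1 = 0 := χ.2
  have h2 : d1 p G ψ.1 = 0 := ψ.2
  refine AddMonoidHom.mem_ker.2 (ContinuousMap.ext fun ⟨g, h, k⟩ => ?_)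
  rw [d2_cup_apply, h1, h2]
  simp

/-- The cup product `H¹ × H¹ → H²`. -/
def cupH (χ ψ : H1 p G) : H2 p G := QuotientAddGroup.mk ⟨cup χ.1 ψ.1, cup_mem_Z2 χ ψ⟩

/-! ### Massey products -/

/-- A defining system for the `k`-fold Massey product `⟨χ₀, …, χ_{k-1}⟩` (`k ≥ 2`): `1`-cochains
`a i j` for `0 ≤ i < j ≤ k`, `(i, j) ≠ (0, k)`, with `a i (i + 1) = χ i` and
`∂ (a i j) = ∑_{i < l < j} a i l ∪ a l j`. The values of `a` at other indices are irrelevant. -/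
structure IsDefiningSystem {k : ℕ} (χ : Fin k → H1 p G) (a : ℕ → ℕ → C(G, ZMod p)) : Prop where
  diag : ∀ i : Fin k, a i (i + 1) = (χ i).1
  coboundary : ∀ i j, i < j → j ≤ k → (i, j) ≠ (0, k) →
    d1 p G (a i j) = ∑ l ∈ Finset.Ioo i j, cup (a i l) (a l j)

/-- The `2`-cochain `∑_{0 < l < k} a 0 l ∪ a l k` attached to a defining system. -/
def masseyCochain (k : ℕ) (a : ℕ → ℕ → C(G, ZMod p)) : C(G × G, ZMod p) :=
  ∑ l ∈ Finset.Ioo 0 k, cup (a 0 l) (a l k)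

theorem IsDefiningSystem.masseyCochain_mem {k : ℕ} {χ : Fin k → H1 p G}
    {a : ℕ → ℕ → C(G, ZMod p)} (ha : IsDefiningSystem χ a) : masseyCochain k a ∈ Z2 p G := by
  refine AddMonoidHom.mem_ker.2 (ContinuousMap.ext fun ⟨g, h, m⟩ => ?_)
  rw [masseyCochain, map_sum, ContinuousMap.sum_apply]
  have e : ∀ l ∈ Finset.Ioo 0 k, d2 p G (cup (a 0 l) (a l k)) (g, h, m) =
      (∑ r ∈ Finset.Ioo 0 l, a 0 r g * a r l h * a l k m)
        - ∑ r ∈ Finset.Ioo l k, a 0 l g * a l r h * a r k m := by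
    intro l hl
    rw [Finset.mem_Ioo] at hl
    rw [d2_cup_apply, ha.coboundary 0 l hl.1 hl.2.le (by simp; omega),
      ha.coboundary l k hl.2 le_rfl (by simp; omega), ContinuousMap.sum_apply,
      ContinuousMap.sum_apply, Finset.sum_mul, Finset.mul_sum]
    simp [cup, mul_assoc]
  rw [Finset.sum_congr rfl e, Finset.sum_sub_distrib, ContinuousMap.zero_apply, sub_eq_zero]
  exact Finset.sum_comm' (by intro u v; simp only [Finset.mem_Ioo]; omega)

/-- The Massey product `⟨χ₀, …, χ_{k-1}⟩ ⊆ H²(G, ℤ/p)` (`k ≥ 2`): the set of the classes of the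
cocycles attached to all defining systems. It is nonempty if and only if a defining system
exists, i.e. if and only if the Massey product is defined. -/
def massey {k : ℕ} (χ : Fin k → H1 p G) : Set (H2 p G) :=
  {c | ∃ (a : ℕ → ℕ → C(G, ZMod p)) (ha : IsDefiningSystem χ a),
    c = QuotientAddGroup.mk ⟨masseyCochain k a, ha.masseyCochain_mem⟩}

/-- The Massey product is defined. -/
def IsDefined {k : ℕ} (χ : Fin k → H1 p G) : Prop := (massey χ).Nonempty

/-- The Massey product vanishes: it is defined and contains `0`. -/
def Vanishes {k : ℕ} (χ : Fin k → H1 p G) : Prop := 0 ∈ massey χ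

/-- The Massey product is strictly defined: it is defined, and every Massey product of a proper
subsequence `χ_i, …, χ_{i+m-1}` of at least two consecutive entries consists of `0` only. -/
def IsStrictlyDefined {k : ℕ} (χ : Fin k → H1 p G) : Prop :=
  IsDefined χ ∧ ∀ (i m : ℕ) (h : i + m ≤ k), 2 ≤ m → m < k →
    massey (fun t : Fin m => χ ⟨i + t, by omega⟩) = {0}

/-- The Massey product is uniquely defined: it consists of exactly one element. -/
def IsUniquelyDefined {k : ℕ} (χ : Fin k → H1 p G) : Prop := ∃! c, c ∈ massey χ

variable (p G)

/-- The `k`-fold Massey vanishing property: every `k`-fold Massey product that is defined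
vanishes. -/
def MasseyVanishingProperty (k : ℕ) : Prop :=
  ∀ χ : Fin k → H1 p G, IsDefined χ → Vanishes χ

/-- The strong `k`-fold Massey vanishing property: a `k`-fold Massey product vanishes as soon as
its proper consecutive two-fold products `χ_i ∪ χ_{i+1}` are zero. For `k ≥ 3` these are all the
products `χ_i ∪ χ_{i+1}`. For `k = 2` there is no proper one, so the property says that all cup
products of elements of `H¹` are zero. -/
def StrongMasseyVanishingProperty (k : ℕ) : Prop :=
  ∀ χ : Fin k → H1 p G,
    (3 ≤ k → ∀ (i : ℕ) (h : i + 1 < k), cupH (χ ⟨i, by omega⟩) (χ ⟨i + 1, h⟩) = 0) → Vanishes χ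

end Cochains

end ProPMassey

/-! A defining system for a `k`-fold Massey product is, up to sign, a unitriangular representation
of size `k + 1` with the upper right corner forgotten. The product vanishes when some representation
with the same superdiagonal has a corner too. Since unitriangular groups over `ℤ/p` are finite
`p`-groups, their representations of the free pro-`p` group `F` are prescribed freely on generators.
The question is thus which representations of `F` are trivial on `R`.

The Zassenhaus filtration controls this. Representations of size `K` kill `F_(K)`
(`map_eq_one_of_mem_zassenhaus`). On `F_(k)` a representation of size `k + 1` depends only on its
superdiagonal (`map_eq_map_of_mem_zassenhaus`). An element of `F_(k)` killed by all of them lies in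
`F_(k+1)` (`IsFreeProP.mem_zassenhaus_succ`).

If `R ⊆ F_(n+1)`, every defining system with `k ≤ n` lifts to a representation of `F` trivial on
`R`; its corner descends to `F/R` and bounds the Massey cocycle. Conversely, let `R ⊆ F_(k)` and let
`ρ` have size `k + 1`. Both minors of `ρ` kill `R`, so `ρ` gives a defining system on `F/R`.
Vanishing yields `ρ'` trivial on `R` with the same superdiagonal, hence `ρ = ρ' = 1` on `R`, and so
`R ⊆ F_(k+1)` (`le_zassenhaus_succ`). -/

namespace ProPMassey

/-! ### Unitriangular matrices -/

section Triangular

variable {R : Type*} [CommRing R] {K : ℕ}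

/-- The matrices that vanish below the `m`-th superdiagonal. -/
def aboveSuperdiag (R : Type*) [CommRing R] (K m : ℕ) :
    Submodule R (Matrix (Fin K) (Fin K) R) where
  carrier := {A | ∀ i j : Fin K, (j : ℕ) < i + m → A i j = 0}
  zero_mem' := by intro i j _; rfl
  add_mem' := by
    intro A B hA hB i j h
    rw [Matrix.add_apply, hA i j h, hB i j h, add_zero]
  smul_mem' := by
    intro c A hA i j h
    rw [Matrix.smul_apply, hA i j h, smul_zero]

theorem aboveSuperdiag_anti {m n : ℕ} (h : m ≤ n) :
    aboveSuperdiag R K n ≤ aboveSuperdiag R K m :=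
  fun _ hA i j hij => hA i j (by omega)

theorem mul_mem_aboveSuperdiag {m n : ℕ} {A B : Matrix (Fin K) (Fin K) R}
    (hA : A ∈ aboveSuperdiag R K m) (hB : B ∈ aboveSuperdiag R K n) :
    A * B ∈ aboveSuperdiag R K (m + n) := by
  intro i j hij
  rw [Matrix.mul_apply]
  refine Finset.sum_eq_zero fun l _ => ?_
  by_cases h : (l : ℕ) < i + m
  · rw [hA i l h, zero_mul]
  · rw [hB l j (by omega), mul_zero]

theorem one_mem_aboveSuperdiag : (1 : Matrix (Fin K) (Fin K) R) ∈ aboveSuperdiag R K 0 := by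
  intro i j h
  exact Matrix.one_apply_ne (by rintro rfl; omega)

theorem pow_mem_aboveSuperdiag {A : Matrix (Fin K) (Fin K) R}
    (hA : A ∈ aboveSuperdiag R K 1) (m : ℕ) : A ^ m ∈ aboveSuperdiag R K m := by
  induction m with
  | zero => rw [pow_zero]; exact one_mem_aboveSuperdiag
  | succ m ih => rw [pow_succ]; exact mul_mem_aboveSuperdiag ih hA

theorem eq_zero_of_mem_aboveSuperdiag {m : ℕ} (h : K ≤ m) {A : Matrix (Fin K) (Fin K) R}
    (hA : A ∈ aboveSuperdiag R K m) : A = 0 := by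
  ext i j
  exact hA i j (by omega)

end Triangular

/-- The upper unitriangular `K × K` matrices over `ℤ/p`. -/
def unitriangular (p K : ℕ) : Submonoid (Matrix (Fin K) (Fin K) (ZMod p)) where
  carrier := {A | A - 1 ∈ aboveSuperdiag (ZMod p) K 1}
  one_mem' := by
    change (1 : Matrix (Fin K) (Fin K) (ZMod p)) - 1 ∈ aboveSuperdiag (ZMod p) K 1
    rw [sub_self]
    exact zero_mem _
  mul_mem' := by
    intro A B hA hB
    change A * B - 1 ∈ aboveSuperdiag (ZMod p) K 1
    have e : A * B - 1 = (A - 1) * (B - 1) + (A - 1) + (B - 1) := by noncomm_ring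
    rw [e]
    exact add_mem (add_mem (aboveSuperdiag_anti (by omega) (mul_mem_aboveSuperdiag hA hB)) hA) hB

section Unitriangular

variable {p K : ℕ}

theorem mem_unitriangular_iff {A : Matrix (Fin K) (Fin K) (ZMod p)} :
    A ∈ unitriangular p K ↔ (∀ i, A i i = 1) ∧ ∀ i j, j < i → A i j = 0 := by
  constructor
  · intro hA
    refine ⟨fun i => ?_, fun i j h => ?_⟩
    · have := hA i i (by omega)
      rwa [Matrix.sub_apply, Matrix.one_apply_eq, sub_eq_zero] at this
    · have := hA i j (by omega)
      rwa [Matrix.sub_apply, Matrix.one_apply_ne h.ne', sub_zero] at this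
  · rintro ⟨h1, h2⟩ i j h
    rw [Matrix.sub_apply, Matrix.one_apply]
    split_ifs with e
    · rw [e, h1, sub_self]
    · rw [h2 i j (by omega), sub_zero]

/-- In characteristic `p`, `A ^ p ^ K - 1 = (A - 1) ^ p ^ K`, and `A - 1` is nilpotent of index at
most `K < p ^ K`. -/
theorem pow_prime_pow_eq_one [Fact p.Prime] {A : Matrix (Fin K) (Fin K) (ZMod p)}
    (hA : A ∈ unitriangular p K) : A ^ p ^ K = 1 := by
  -- For `K = 0` the matrix ring is zero and does not have characteristic `p`.
  rcases K.eq_zero_or_pos with rfl | hK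
  · exact Subsingleton.elim _ _
  · have : Nonempty (Fin K) := ⟨⟨0, hK⟩⟩
    have h0 : (A - 1) ^ p ^ K = 0 :=
      eq_zero_of_mem_aboveSuperdiag (K.lt_pow_self (Fact.out : p.Prime).one_lt).le
        (pow_mem_aboveSuperdiag hA _)
    rw [sub_pow_char_pow_of_commute p K (Commute.one_right A), one_pow, sub_eq_zero] at h0
    exact h0

instance [Fact p.Prime] : Group (unitriangular p K) :=
  { (inferInstance : Monoid (unitriangular p K)) with
    inv := fun A => A ^ (p ^ K - 1)
    inv_mul_cancel := fun A => by
      change A ^ (p ^ K - 1) * A = 1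
      rw [← pow_succ, Nat.sub_add_cancel (Nat.one_le_pow _ _ (Fact.out : p.Prime).pos)]
      exact Subtype.ext (by simpa using pow_prime_pow_eq_one A.2) }

theorem isPGroup_unitriangular [Fact p.Prime] : IsPGroup p (unitriangular p K) :=
  fun A => ⟨K, Subtype.ext (by simpa using pow_prime_pow_eq_one A.2)⟩

theorem sum_Ioo_val {M : Type*} [AddCommMonoid M] (i j : Fin K) (f : ℕ → M) :
    ∑ l ∈ Finset.Ioo i j, f l = ∑ l ∈ Finset.Ioo (i : ℕ) j, f l := by
  rw [← Fin.map_valEmbedding_Ioo, Finset.sum_map]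
  rfl

/-- The sum is the cup product term of the defining system equations; this is where matrices meet
cochains. -/
theorem unitriangular_mul_apply {A B : Matrix (Fin K) (Fin K) (ZMod p)}
    (hA : A ∈ unitriangular p K) (hB : B ∈ unitriangular p K) {i j : Fin K} (hij : i < j) :
    (A * B) i j = A i j + B i j + ∑ l ∈ Finset.Ioo i j, A i l * B l j := by
  rw [mem_unitriangular_iff] at hA hB
  rw [Matrix.mul_apply, ← Finset.sum_subset (Finset.subset_univ (Finset.Icc i j)),
    ← Finset.Ioc_insert_left hij.le, Finset.sum_insert (by simp),
    ← Finset.Ioo_insert_right hij, Finset.sum_insert (by simp), hA.1, hB.1]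
  · ring
  · intro l _ hl
    rw [Finset.mem_Icc, not_and_or, not_le, not_le] at hl
    rcases hl with hl | hl
    · rw [hA.2 i l hl, zero_mul]
    · rw [hB.2 l j hl, mul_zero]

theorem unitriangular_ext {A B : unitriangular p K}
    (h : ∀ i j, i < j → A.1 i j = B.1 i j) : A = B := by
  refine Subtype.ext (Matrix.ext fun i j => ?_)
  have hA := mem_unitriangular_iff.1 A.2
  have hB := mem_unitriangular_iff.1 B.2
  rcases lt_trichotomy i j with e | rfl | e
  · exact h i j e
  · rw [hA.1, hB.1]
  · rw [hA.2 i j e, hB.2 i j e]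

/-- The upper left minor of a unitriangular matrix. -/
def minorLeft [Fact p.Prime] : unitriangular p (K + 1) →* unitriangular p K where
  toFun A := ⟨A.1.submatrix Fin.castSucc Fin.castSucc, mem_unitriangular_iff.2
    ⟨fun i => (mem_unitriangular_iff.1 A.2).1 _, fun i j h =>
      (mem_unitriangular_iff.1 A.2).2 _ _ (Fin.castSucc_lt_castSucc_iff.2 h)⟩⟩
  map_one' := Subtype.ext (Matrix.submatrix_one _ (Fin.castSucc_injective K))
  map_mul' A B := by
    refine Subtype.ext (Matrix.ext fun i j => ?_)
    change (A.1 * B.1) _ _ = _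
    rw [Matrix.mul_apply, Fin.sum_univ_castSucc,
      (mem_unitriangular_iff.1 B.2).2 _ _ (Fin.castSucc_lt_last j), mul_zero, add_zero]
    rfl

/-- The lower right minor of a unitriangular matrix. -/
def minorRight [Fact p.Prime] : unitriangular p (K + 1) →* unitriangular p K where
  toFun A := ⟨A.1.submatrix Fin.succ Fin.succ, mem_unitriangular_iff.2
    ⟨fun i => (mem_unitriangular_iff.1 A.2).1 _, fun i j h =>
      (mem_unitriangular_iff.1 A.2).2 _ _ (Fin.succ_lt_succ_iff.2 h)⟩⟩
  map_one' := Subtype.ext (Matrix.submatrix_one _ (Fin.succ_injective K))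
  map_mul' A B := by
    refine Subtype.ext (Matrix.ext fun i j => ?_)
    change (A.1 * B.1) _ _ = _
    rw [Matrix.mul_apply, Fin.sum_univ_succ,
      (mem_unitriangular_iff.1 A.2).2 _ _ (Fin.succ_pos i), zero_mul, zero_add]
    rfl

/-- The upper left minor of a continuous unitriangular representation. -/
def compMinorLeft [Fact p.Prime] {F : Type*} [Group F] [TopologicalSpace F]
    (ρ : F →ₜ* unitriangular p (K + 1)) : F →ₜ* unitriangular p K where
  toMonoidHom := minorLeft.comp ρ.toMonoidHom
  continuous_toFun := (continuous_of_discreteTopology (f := minorLeft)).comp ρ.continuous_toFun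

/-- The lower right minor of a continuous unitriangular representation. -/
def compMinorRight [Fact p.Prime] {F : Type*} [Group F] [TopologicalSpace F]
    (ρ : F →ₜ* unitriangular p (K + 1)) : F →ₜ* unitriangular p K where
  toMonoidHom := minorRight.comp ρ.toMonoidHom
  continuous_toFun := (continuous_of_discreteTopology (f := minorRight)).comp ρ.continuous_toFun

end Unitriangular

/-! ### Powers of the augmentation ideal -/

section Augmentation

variable {p : ℕ}

theorem of_sub_one_mem {H : Type*} [Group H] (h : H) :
    MonoidAlgebra.of (ZMod p) H h - 1 ∈ augmentationIdeal p H := by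
  rw [augmentationIdeal, RingHom.mem_ker, map_sub, sub_eq_zero]
  exact (MonoidAlgebra.lift_of 1 h).trans (map_one (MonoidAlgebra.lift (ZMod p) (ZMod p) H 1)).symm

instance {H : Type*} [Group H] : (augmentationIdeal p H).IsTwoSided := by
  unfold augmentationIdeal
  infer_instance

theorem mem_augmentationIdeal_pow_zero {H : Type*} [Group H] (z : MonoidAlgebra (ZMod p) H) :
    z ∈ augmentationIdeal p H ^ 0 := by
  rw [Submodule.pow_zero, Ideal.one_eq_top]
  trivial

theorem exists_smul_one_add {H : Type*} [Group H] (z : MonoidAlgebra (ZMod p) H) :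
    ∃ c : ZMod p, z - c • 1 ∈ augmentationIdeal p H := by
  refine ⟨MonoidAlgebra.lift (ZMod p) (ZMod p) H 1 z, ?_⟩
  rw [augmentationIdeal, RingHom.mem_ker, map_sub]
  simp

/-- The augmentation ideal is spanned by the elements `h - 1`. -/
theorem augmentationIdeal_le {H : Type*} [Group H]
    (V : Submodule (ZMod p) (MonoidAlgebra (ZMod p) H))
    (hV : ∀ h, MonoidAlgebra.of (ZMod p) H h - 1 ∈ V) :
    (augmentationIdeal p H).restrictScalars (ZMod p) ≤ V := by
  -- Subtracting the augmentation gives a statement linear in `z`, which can be checked on group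
  -- elements.
  have key : ∀ z : MonoidAlgebra (ZMod p) H,
      z - (MonoidAlgebra.lift (ZMod p) (ZMod p) H 1 z) • 1 ∈ V := by
    intro z
    induction z using MonoidAlgebra.induction_on with
    | of h =>
      rw [MonoidAlgebra.lift_of, MonoidHom.one_apply, one_smul]
      exact hV h
    | add x y hx hy =>
      have := add_mem hx hy
      rwa [sub_add_sub_comm, ← add_smul, ← map_add] at this
    | smul c x hx =>
      have := V.smul_mem c hx
      rwa [smul_sub, smul_smul, ← smul_eq_mul, ← map_smul] at this
  intro z hz
  have h0 : MonoidAlgebra.lift (ZMod p) (ZMod p) H 1 z = 0 := hz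
  have := key z
  rwa [h0, zero_smul, sub_zero] at this

theorem map_mem_augmentationIdeal_pow {H H' : Type*} [Group H] [Group H'] (f : H →* H') (m : ℕ)
    {z : MonoidAlgebra (ZMod p) H} (hz : z ∈ augmentationIdeal p H ^ m) :
    MonoidAlgebra.mapDomainAlgHom (ZMod p) (ZMod p) f z ∈ augmentationIdeal p H' ^ m := by
  induction m generalizing z with
  | zero => exact mem_augmentationIdeal_pow_zero _
  | succ m ih =>
    rw [Submodule.pow_succ] at hz ⊢
    refine Submodule.mul_induction_on hz (fun a ha b hb => ?_) (fun a b ha hb => ?_)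
    · rw [map_mul]
      refine Submodule.mul_mem_mul (ih ha) ?_
      have := augmentationIdeal_le (((augmentationIdeal p H').restrictScalars (ZMod p)).comap
        (MonoidAlgebra.mapDomainAlgHom (ZMod p) (ZMod p) f).toLinearMap) (fun h => ?_) hb
      · exact this
      · have := of_sub_one_mem (p := p) (f h)
        simpa [map_sub, MonoidAlgebra.one_def] using this
    · rw [map_add]
      exact add_mem ha hb

/-- If elements `y i` generate the augmentation ideal `I` modulo `I ^ 2`, then their products of
length `m` generate `I ^ m` modulo `I ^ (m + 1)`. -/
theorem augmentationIdeal_pow_le {H : Type*} [Group H]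
    (V : Submodule (ZMod p) (MonoidAlgebra (ZMod p) H))
    (hVI : V ≤ (augmentationIdeal p H).restrictScalars (ZMod p))
    (hV : ∀ z ∈ augmentationIdeal p H, ∃ s ∈ V, z - s ∈ augmentationIdeal p H ^ 2) (m : ℕ)
    {z : MonoidAlgebra (ZMod p) H} (hz : z ∈ augmentationIdeal p H ^ m) :
    ∃ s ∈ V ^ m, z - s ∈ augmentationIdeal p H ^ (m + 1) := by
  have hVm : ∀ m, ∀ s ∈ V ^ m, s ∈ augmentationIdeal p H ^ m := by
    intro m
    induction m with
    | zero => exact fun s _ => mem_augmentationIdeal_pow_zero s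
    | succ m ih =>
      intro s hs
      rw [pow_succ] at hs
      rw [Submodule.pow_succ]
      exact Submodule.mul_induction_on hs
        (fun a ha b hb => Submodule.mul_mem_mul (ih a ha) (hVI hb)) (fun a b ha hb => add_mem ha hb)
  induction m generalizing z with
  | zero =>
    obtain ⟨c, hc⟩ := exists_smul_one_add z
    refine ⟨c • 1, ?_, by rwa [zero_add, Submodule.pow_one]⟩
    rw [pow_zero]
    exact Submodule.smul_mem _ c (Submodule.one_le.1 le_rfl)
  | succ m ih =>
    rw [Submodule.pow_succ] at hz
    refine Submodule.mul_induction_on hz (fun a ha b hb => ?_) (fun a b ha hb => ?_)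
    · obtain ⟨s, hs, hs'⟩ := ih ha
      obtain ⟨t, ht, ht'⟩ := hV b hb
      refine ⟨s * t, by rw [pow_succ]; exact Submodule.mul_mem_mul hs ht, ?_⟩
      have e : a * b - s * t = (a - s) * b + s * (b - t) := by noncomm_ring
      rw [e]
      refine add_mem ?_ ?_
      · rw [Submodule.pow_succ]
        exact Submodule.mul_mem_mul hs' hb
      · rw [add_assoc, Submodule.pow_add _ (by omega)]
        exact Submodule.mul_mem_mul (hVm m s hs) ht'
    · obtain ⟨s, hs, hs'⟩ := ha
      obtain ⟨t, ht, ht'⟩ := hb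
      refine ⟨s + t, add_mem hs ht, ?_⟩
      rw [add_sub_add_comm]
      exact add_mem hs' ht'

end Augmentation

/-! ### Unitriangular representations and the Zassenhaus filtration -/

section Representation

variable {p K : ℕ} [Fact p.Prime] {F : Type*} [Group F] [TopologicalSpace F]

/-- The kernel of a continuous homomorphism to a discrete group. -/
def openKer {P : Type*} [Group P] [TopologicalSpace P] [DiscreteTopology P]
    (ρ : F →ₜ* P) : OpenNormalSubgroup F where
  toSubgroup := ρ.toMonoidHom.ker
  isOpen' := (isOpen_discrete ({1} : Set P)).preimage ρ.continuous_toFun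
  isNormal' := MonoidHom.normal_ker _

/-- The algebra homomorphism from a group algebra to the algebra of matrices attached to a
unitriangular representation. -/
noncomputable def algebraRep {N : Subgroup F} [N.Normal] (ρ : F →ₜ* unitriangular p K)
    (h : ∀ g ∈ N, ρ g = 1) :
    MonoidAlgebra (ZMod p) (F ⧸ N) →ₐ[ZMod p] Matrix (Fin K) (Fin K) (ZMod p) :=
  MonoidAlgebra.lift _ _ _
    ((unitriangular p K).subtype.comp (QuotientGroup.lift N ρ.toMonoidHom h))

theorem algebraRep_of {N : Subgroup F} [N.Normal] (ρ : F →ₜ* unitriangular p K)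
    (h : ∀ g ∈ N, ρ g = 1) (g : F) :
    algebraRep ρ h (MonoidAlgebra.of (ZMod p) (F ⧸ N) (QuotientGroup.mk g)) = (ρ g).1 :=
  MonoidAlgebra.lift_of _ _

theorem algebraRep_mem {N : Subgroup F} [N.Normal] (ρ : F →ₜ* unitriangular p K)
    (h : ∀ g ∈ N, ρ g = 1) {z : MonoidAlgebra (ZMod p) (F ⧸ N)}
    (hz : z ∈ augmentationIdeal p (F ⧸ N)) : algebraRep ρ h z ∈ aboveSuperdiag (ZMod p) K 1 := by
  refine augmentationIdeal_le ((aboveSuperdiag (ZMod p) K 1).comap (algebraRep ρ h).toLinearMap)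
    (fun g => ?_) hz
  obtain ⟨g, rfl⟩ := QuotientGroup.mk_surjective g
  change algebraRep ρ h _ ∈ aboveSuperdiag (ZMod p) K 1
  rw [map_sub, algebraRep_of, map_one]
  exact (ρ g).2

/-- The augmentation ideal acts by strictly upper triangular matrices, and each further factor moves
up one superdiagonal. -/
theorem algebraRep_mem_pow {N : Subgroup F} [N.Normal] (ρ : F →ₜ* unitriangular p K)
    (h : ∀ g ∈ N, ρ g = 1) (m : ℕ) {z : MonoidAlgebra (ZMod p) (F ⧸ N)}
    (hz : z ∈ augmentationIdeal p (F ⧸ N) ^ m) :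
    algebraRep ρ h z ∈ aboveSuperdiag (ZMod p) K m := by
  induction m generalizing z with
  | zero =>
    obtain ⟨c, hc⟩ := exists_smul_one_add z
    rw [← sub_add_cancel z (c • 1), map_add, map_smul, map_one]
    exact add_mem (aboveSuperdiag_anti (by omega) (algebraRep_mem ρ h hc))
      (Submodule.smul_mem _ c one_mem_aboveSuperdiag)
  | succ m ih =>
    rw [Submodule.pow_succ] at hz
    refine Submodule.mul_induction_on hz (fun a ha b hb => ?_) (fun a b ha hb => ?_)
    · rw [map_mul]
      exact mul_mem_aboveSuperdiag (ih ha) (algebraRep_mem ρ h hb)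
    · rw [map_add]
      exact add_mem ha hb

/-- Agreement on the superdiagonal makes the two representations differ on the ideal by one level
more than expected; telescoping a product keeps this gain of one level. -/
theorem algebraRep_sub_mem {N : Subgroup F} [N.Normal] {ρ ρ' : F →ₜ* unitriangular p K}
    (h : ∀ g ∈ N, ρ g = 1) (h' : ∀ g ∈ N, ρ' g = 1)
    (hρ : ∀ g, (ρ g).1 - (ρ' g).1 ∈ aboveSuperdiag (ZMod p) K 2) (m : ℕ)
    {z : MonoidAlgebra (ZMod p) (F ⧸ N)} (hz : z ∈ augmentationIdeal p (F ⧸ N) ^ m) :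
    algebraRep ρ h z - algebraRep ρ' h' z ∈ aboveSuperdiag (ZMod p) K (m + 1) := by
  have key : ∀ z ∈ augmentationIdeal p (F ⧸ N),
      algebraRep ρ h z - algebraRep ρ' h' z ∈ aboveSuperdiag (ZMod p) K 2 := by
    intro z hz
    refine augmentationIdeal_le ((aboveSuperdiag (ZMod p) K 2).comap
      ((algebraRep ρ h).toLinearMap - (algebraRep ρ' h').toLinearMap)) (fun g => ?_) hz
    obtain ⟨g, rfl⟩ := QuotientGroup.mk_surjective g
    change algebraRep ρ h _ - algebraRep ρ' h' _ ∈ aboveSuperdiag (ZMod p) K 2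
    rw [map_sub, map_sub, algebraRep_of, algebraRep_of, map_one, map_one, sub_sub_sub_cancel_right]
    exact hρ g
  induction m generalizing z with
  | zero =>
    obtain ⟨c, hc⟩ := exists_smul_one_add z
    have := aboveSuperdiag_anti (m := 1) (by omega) (key _ hc)
    rwa [map_sub, map_sub, map_smul, map_smul, map_one, map_one, sub_sub_sub_cancel_right] at this
  | succ m ih =>
    rw [Submodule.pow_succ] at hz
    refine Submodule.mul_induction_on hz (fun a ha b hb => ?_) (fun a b ha hb => ?_)
    · have e : algebraRep ρ h (a * b) - algebraRep ρ' h' (a * b) =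
          (algebraRep ρ h a - algebraRep ρ' h' a) * algebraRep ρ h b +
            algebraRep ρ' h' a * (algebraRep ρ h b - algebraRep ρ' h' b) := by
        rw [map_mul, map_mul]
        noncomm_ring
      rw [e]
      exact add_mem (mul_mem_aboveSuperdiag (ih ha) (algebraRep_mem ρ h hb))
        (mul_mem_aboveSuperdiag (m := m) (n := 2) (algebraRep_mem_pow ρ' h' m ha) (key b hb))
    · rw [map_add, map_add, add_sub_add_comm]
      exact add_mem ha hb

theorem map_eq_one_of_mem_zassenhaus {f : F} (hf : f ∈ zassenhaus p F K)
    (ρ : F →ₜ* unitriangular p K) : ρ f = 1 := by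
  have hN : ∀ g ∈ (openKer ρ).toSubgroup, ρ g = 1 := fun _ hg => hg
  have h := algebraRep_mem_pow ρ hN K (hf (openKer ρ))
  have := eq_zero_of_mem_aboveSuperdiag le_rfl h
  rw [map_sub, algebraRep_of, map_one, sub_eq_zero] at this
  exact Subtype.ext this

/-- On the `k`-th step of the Zassenhaus filtration, a unitriangular representation of size `k + 1`
is determined by its superdiagonal. -/
theorem map_eq_map_of_mem_zassenhaus {k : ℕ} {f : F} (hf : f ∈ zassenhaus p F k)
    (ρ ρ' : F →ₜ* unitriangular p (k + 1))
    (hρ : ∀ g (i : Fin k), (ρ g).1 i.castSucc i.succ = (ρ' g).1 i.castSucc i.succ) :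
    ρ f = ρ' f := by
  have h2 : ∀ g, (ρ g).1 - (ρ' g).1 ∈ aboveSuperdiag (ZMod p) (k + 1) 2 := by
    intro g i j hij
    have h1 := mem_unitriangular_iff.1 (ρ g).2
    have h1' := mem_unitriangular_iff.1 (ρ' g).2
    rw [Matrix.sub_apply, sub_eq_zero]
    rcases lt_trichotomy i j with e | rfl | e
    · have := hρ g ⟨i, by omega⟩
      have hj : j = Fin.succ ⟨i, by omega⟩ := Fin.ext (by simp; omega)
      rw [hj]
      exact this
    · rw [h1.1, h1'.1]
    · rw [h1.2 i j e, h1'.2 i j e]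
  -- The intersection of the kernels lets both representations factor through the same finite
  -- quotient.
  have hN : ∀ g ∈ (openKer ρ ⊓ openKer ρ').toSubgroup, ρ g = 1 := fun _ hg => hg.1
  have hN' : ∀ g ∈ (openKer ρ ⊓ openKer ρ').toSubgroup, ρ' g = 1 := fun _ hg => hg.2
  have h := algebraRep_sub_mem hN hN' h2 k (hf (openKer ρ ⊓ openKer ρ'))
  have := eq_zero_of_mem_aboveSuperdiag le_rfl h
  rw [map_sub, map_sub, algebraRep_of, algebraRep_of, map_one, map_one, sub_sub_sub_cancel_right,
    sub_eq_zero] at this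
  exact Subtype.ext this

end Representation

/-! ### Free pro-`p` groups -/

/-- The matrix with the given superdiagonal and zeros elsewhere. -/
def superdiag {R : Type*} [Zero R] {k : ℕ} (c : Fin k → R) :
    Matrix (Fin (k + 1)) (Fin (k + 1)) R :=
  Matrix.of fun i j => if h : (i : ℕ) + 1 = j then c ⟨i, by omega⟩ else 0

theorem superdiag_apply {R : Type*} [Zero R] {k : ℕ} (c : Fin k → R) (i j : Fin (k + 1)) :
    superdiag c i j = if h : (i : ℕ) + 1 = j then c ⟨i, by omega⟩ else 0 := rfl

theorem superdiag_mem {R : Type*} [CommRing R] {k : ℕ} (c : Fin k → R) :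
    superdiag c ∈ aboveSuperdiag R (k + 1) 1 := by
  intro i j h
  rw [superdiag_apply, dif_neg (by omega)]

/-- From index `0` the only contributing path is `0 → 1 → ⋯ → m`. For `m = k` this reads off the
corner. -/
theorem prod_superdiag_apply {R : Type*} [CommRing R] {k : ℕ} (m : ℕ) (hm : m ≤ k)
    (c : Fin m → Fin k → R) (j : Fin (k + 1)) :
    (List.ofFn fun t => superdiag (c t)).prod 0 j =
      if (j : ℕ) = m then ∏ t, c t (Fin.castLE hm t) else 0 := by
  induction m generalizing j with
  | zero =>
    rw [List.ofFn_zero, List.prod_nil, Matrix.one_apply, Fin.prod_univ_zero]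
    exact if_congr (by rw [Fin.ext_iff, eq_comm]; rfl) rfl rfl
  | succ m ih =>
    rw [List.ofFn_succ', List.concat_eq_append, List.prod_append, List.prod_singleton,
      Matrix.mul_apply, Finset.sum_eq_single (⟨m, by omega⟩ : Fin (k + 1)), ih (by omega),
      if_pos rfl, superdiag_apply, Fin.prod_univ_castSucc]
    · simp only [eq_comm (a := m + 1), mul_dite, mul_zero]
      rfl
    · intro l _ hl
      rw [ih (by omega), if_neg (fun h => hl (Fin.ext h)), zero_mul]
    · exact fun h => absurd (Finset.mem_univ _) h

section Free

variable {p : ℕ} [Fact p.Prime] {F : Type*} [Group F] [TopologicalSpace F] {d : ℕ} {x : Fin d → F}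

theorem IsFreeProP.exists_rep (hF : IsFreeProP p x) {K : ℕ} (y : Fin d → unitriangular p K) :
    ∃ ρ : F →ₜ* unitriangular p K, ∀ t, ρ (x t) = y t :=
  (hF.existsUnique_lift _ isPGroup_unitriangular y).exists

theorem IsFreeProP.rep_ext (hF : IsFreeProP p x) {K : ℕ} {ρ ρ' : F →ₜ* unitriangular p K}
    (h : ∀ t, ρ (x t) = ρ' (x t)) : ρ = ρ' :=
  (hF.existsUnique_lift _ isPGroup_unitriangular fun t => ρ (x t)).unique (fun _ => rfl)
    fun t => (h t).symm

theorem IsFreeProP.exists_rep_superdiag (hF : IsFreeProP p x) {k : ℕ}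
    (c : Fin d → Fin k → ZMod p) :
    ∃ ρ : F →ₜ* unitriangular p (k + 1), ∀ t, (ρ (x t)).1 = 1 + superdiag (c t) := by
  obtain ⟨ρ, hρ⟩ := hF.exists_rep (p := p) fun t => (⟨1 + superdiag (c t), by
    change 1 + superdiag (c t) - 1 ∈ aboveSuperdiag (ZMod p) (k + 1) 1
    rw [add_sub_cancel_left]
    exact superdiag_mem _⟩ : unitriangular p (k + 1))
  exact ⟨ρ, fun t => by rw [hρ]⟩

theorem isPGroup_multiplicative_zmod : IsPGroup p (Multiplicative (ZMod p)) := by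
  intro a
  refine ⟨1, ?_⟩
  rw [pow_one]
  exact Multiplicative.toAdd.injective (by simp)

theorem IsFreeProP.hom_eq_zero (hF : IsFreeProP p x) (φ : F → ZMod p) (hφ : Continuous φ)
    (hmul : ∀ f g, φ (f * g) = φ f + φ g) (h : ∀ t, φ (x t) = 0) (f : F) : φ f = 0 := by
  let ψ : F →ₜ* Multiplicative (ZMod p) :=
    { toMonoidHom := MonoidHom.mk' (fun f => Multiplicative.ofAdd (φ f)) fun f g => by
        rw [hmul, ofAdd_add]
      continuous_toFun := continuous_ofAdd.comp hφ }
  have : ψ = 1 := (hF.existsUnique_lift _ isPGroup_multiplicative_zmod fun _ => 1).unique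
    (fun t => congrArg Multiplicative.ofAdd (h t)) (fun t => rfl)
  exact congrArg Multiplicative.toAdd (DFunLike.congr_fun this f)

/-- The augmentation ideal `I` of `𝔽_p[F/N]` is generated modulo `I ^ 2` by the elements
`x_t - 1`. -/
theorem IsFreeProP.exists_sub_mem_sq (hF : IsFreeProP p x) (N : OpenNormalSubgroup F)
    (z : MonoidAlgebra (ZMod p) (F ⧸ N.toSubgroup))
    (hz : z ∈ augmentationIdeal p (F ⧸ N.toSubgroup)) :
    ∃ s ∈ Submodule.span (ZMod p) (Set.range fun t =>
        MonoidAlgebra.of (ZMod p) (F ⧸ N.toSubgroup) (QuotientGroup.mk (x t)) - 1),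
      z - s ∈ augmentationIdeal p (F ⧸ N.toSubgroup) ^ 2 := by
  have := hF.isProP.isTopologicalGroup
  set V := Submodule.span (ZMod p) (Set.range fun t =>
    MonoidAlgebra.of (ZMod p) (F ⧸ N.toSubgroup) (QuotientGroup.mk (x t)) - 1) with hV
  set J := (augmentationIdeal p (F ⧸ N.toSubgroup) ^ 2).restrictScalars (ZMod p) with hJ
  have key : (augmentationIdeal p (F ⧸ N.toSubgroup)).restrictScalars (ZMod p) ≤ J ⊔ V := by
    refine augmentationIdeal_le _ fun h => ?_
    obtain ⟨g, rfl⟩ := QuotientGroup.mk_surjective h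
    -- Otherwise a functional `l` kills `I ^ 2` and all `x_t - 1`, but not `g - 1`. Since `(f - 1)(g
    -- - 1) ∈ I ^ 2`, the map `f ↦ l (f - 1)` is a homomorphism to `ℤ/p` that is trivial on
    -- generators, hence zero.
    by_contra hg
    obtain ⟨l, hl, hle⟩ := Submodule.exists_le_ker_of_notMem hg
    refine hl (hF.hom_eq_zero (fun f => l (MonoidAlgebra.of (ZMod p) (F ⧸ N.toSubgroup)
      (QuotientGroup.mk f) - 1)) ?_ (fun f g => ?_) (fun t => ?_) g)
    · have := QuotientGroup.discreteTopology N.isOpen'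
      exact (continuous_of_discreteTopology
        (f := fun h => l (MonoidAlgebra.of (ZMod p) (F ⧸ N.toSubgroup) h - 1))).comp
          QuotientGroup.continuous_mk
    · have h0 : l ((MonoidAlgebra.of (ZMod p) (F ⧸ N.toSubgroup) (QuotientGroup.mk f) - 1) *
          (MonoidAlgebra.of (ZMod p) (F ⧸ N.toSubgroup) (QuotientGroup.mk g) - 1)) = 0 := by
        refine hle (Submodule.mem_sup_left ?_)
        change _ ∈ augmentationIdeal p (F ⧸ N.toSubgroup) ^ (1 + 1)
        rw [Submodule.pow_succ, Submodule.pow_one]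
        exact Submodule.mul_mem_mul (of_sub_one_mem _) (of_sub_one_mem _)
      rw [← map_add, ← sub_eq_zero, ← map_sub, ← h0, QuotientGroup.mk_mul, map_mul]
      congr 1
      noncomm_ring
    · exact hle (Submodule.mem_sup_right (Submodule.subset_span ⟨t, rfl⟩))
  obtain ⟨a, ha, s, hs, e⟩ := Submodule.mem_sup.1 (key hz)
  refine ⟨s, hs, ?_⟩
  rw [← e, add_sub_cancel_right]
  exact ha

/-- An element of `F_(k)` on which all unitriangular representations of size `k + 1` are trivial
lies in `F_(k+1)`. -/
theorem IsFreeProP.mem_zassenhaus_succ (hF : IsFreeProP p x) {k : ℕ} {f : F}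
    (hf : f ∈ zassenhaus p F k) (h : ∀ ρ : F →ₜ* unitriangular p (k + 1), ρ f = 1) :
    f ∈ zassenhaus p F (k + 1) := by
  intro N
  -- For each word `v` of length `k`, `ρ v` is built so that the corner of the image of `∏ (x_{w j}
  -- - 1)` is `1` if `w = v` and `0` otherwise. It extracts the coefficient of `v`.
  choose ρ hρ using fun v : Fin k → Fin d =>
    hF.exists_rep_superdiag fun t i => if v i = t then (1 : ZMod p) else 0
  let σ : F →ₜ* ((Fin k → Fin d) → unitriangular p (k + 1)) :=
    { toMonoidHom := MonoidHom.pi fun v => (ρ v).toMonoidHom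
      continuous_toFun := continuous_pi fun v => (ρ v).continuous_toFun }
  -- There are finitely many words, so all the `ρ v` factor through one smaller open quotient.
  set N' := N ⊓ openKer σ with hN'
  have hker : ∀ v, ∀ g ∈ N'.toSubgroup, ρ v g = 1 := fun v g hg => congrFun hg.2 v
  set X : Fin d → MonoidAlgebra (ZMod p) (F ⧸ N'.toSubgroup) := fun t =>
    MonoidAlgebra.of (ZMod p) (F ⧸ N'.toSubgroup) (QuotientGroup.mk (x t)) - 1 with hX
  have hpow : Submodule.span (ZMod p) (Set.range X) ^ k =
      Submodule.span (ZMod p) (Set.range fun w : Fin k → Fin d =>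
        (List.ofFn fun j => X (w j)).prod) := by
    rw [Submodule.span_pow]
    congr 1
    ext a
    rw [Set.mem_pow]
    constructor
    · rintro ⟨u, rfl⟩
      choose w hw using fun j => (u j).2
      exact ⟨w, by simp only [hw]⟩
    · rintro ⟨w, rfl⟩
      exact ⟨fun j => ⟨X (w j), w j, rfl⟩, rfl⟩
  obtain ⟨s, hs, hs'⟩ := augmentationIdeal_pow_le (Submodule.span (ZMod p) (Set.range X))
    (Submodule.span_le.2 (by rintro _ ⟨t, rfl⟩; exact of_sub_one_mem _))
    (hF.exists_sub_mem_sq N') k (hf N')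
  rw [hpow, Submodule.mem_span_range_iff_exists_fun] at hs
  obtain ⟨c, rfl⟩ := hs
  have hc : ∀ v, c v = 0 := by
    intro v
    -- The difference of `f - 1` and its degree `k` part lies in `I ^ (k + 1)`, which `ρ v` kills.
    -- As `ρ v f = 1`, the degree `k` part is killed too.
    have h0 := eq_zero_of_mem_aboveSuperdiag le_rfl (algebraRep_mem_pow (ρ v) (hker v) _ hs')
    rw [map_sub, map_sub, algebraRep_of, map_one, h (ρ v), OneMemClass.coe_one, sub_self, zero_sub,
      neg_eq_zero, map_sum] at h0
    have h1 := congrFun (congrFun h0 0) (Fin.last k)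
    rw [Matrix.sum_apply, Finset.sum_eq_single v] at h1
    · simp only [map_smul, map_list_prod, List.map_ofFn, Function.comp_def] at h1
      simpa only [hX, map_sub, algebraRep_of, hρ, map_one, add_sub_cancel_left, Matrix.smul_apply,
        prod_superdiag_apply k le_rfl, Fin.val_last, if_true, Fin.castLE_rfl, id_eq,
        Finset.prod_const_one, smul_eq_mul, mul_one, Matrix.zero_apply] using h1
    · intro w _ hw
      have hw' : ∃ j, v j ≠ w j := by
        by_contra! hvw
        exact hw (funext fun j => (hvw j).symm)
      obtain ⟨j, hj⟩ := hw'
      simp only [map_smul, map_list_prod, List.map_ofFn, Function.comp_def]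
      simp only [hX, map_sub, algebraRep_of, hρ, map_one, add_sub_cancel_left, Matrix.smul_apply,
        prod_superdiag_apply k le_rfl, Fin.val_last, if_true]
      rw [Finset.prod_eq_zero (Finset.mem_univ j) (if_neg hj), smul_zero]
    · exact fun hv => absurd (Finset.mem_univ _) hv
  simp only [hc, zero_smul, Finset.sum_const_zero, sub_zero] at hs'
  have hNN : N'.toSubgroup ≤ N.toSubgroup.comap (MonoidHom.id F) := fun _ hg => hg.1
  have := map_mem_augmentationIdeal_pow
    (QuotientGroup.map N'.toSubgroup N.toSubgroup (MonoidHom.id F) hNN) _ hs'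
  rw [map_sub, map_one] at this
  have e : MonoidAlgebra.mapDomainAlgHom (ZMod p) (ZMod p)
      (QuotientGroup.map N'.toSubgroup N.toSubgroup (MonoidHom.id F) hNN)
      (MonoidAlgebra.of (ZMod p) (F ⧸ N'.toSubgroup) (QuotientGroup.mk f)) =
      MonoidAlgebra.of (ZMod p) (F ⧸ N.toSubgroup) (QuotientGroup.mk f) := by
    simp only [MonoidAlgebra.of_apply, MonoidAlgebra.mapDomainAlgHom_apply,
      MonoidAlgebra.mapDomain_single]
    rfl
  rwa [e] at this

end Free

/-! ### Defining systems and unitriangular representations -/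

section CochainRep

variable {p K : ℕ} {G : Type*} [TopologicalSpace G]

/-- The unitriangular matrix with entries `-b i j g` above the diagonal. -/
def cochainMatrix (K : ℕ) (b : ℕ → ℕ → C(G, ZMod p)) (g : G) : unitriangular p K :=
  ⟨Matrix.of fun i j : Fin K => if i = j then 1 else if i < j then -(b i j g) else 0,
    mem_unitriangular_iff.2 ⟨fun i => by simp, fun i j h => by simp [h.ne', h.not_gt]⟩⟩

theorem cochainMatrix_apply (b : ℕ → ℕ → C(G, ZMod p)) (g : G) {i j : Fin K} (h : i < j) :
    (cochainMatrix K b g).1 i j = -(b i j g) := by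
  change (if i = j then (1 : ZMod p) else if i < j then -(b i j g) else 0) = _
  rw [if_neg h.ne, if_pos h]

variable [Group G] [IsTopologicalGroup G]

theorem mk_eq_zero_iff (c : Z2 p G) :
    (QuotientAddGroup.mk c : H2 p G) = 0 ↔ ∃ b, d1 p G b = c.1 := by
  rw [QuotientAddGroup.eq_zero_iff, AddSubgroup.mem_addSubgroupOf]
  rfl

variable [Fact p.Prime]

/-- The minus signs match the convention `(∂b)(g, h) = b(h) - b(gh) + b(g)`: the linear terms change
sign and the products do not. -/
theorem cochainMatrix_mul {b : ℕ → ℕ → C(G, ZMod p)} (hb : ∀ i j, i < j → j < K →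
    d1 p G (b i j) = ∑ l ∈ Finset.Ioo i j, cup (b i l) (b l j)) (g h : G) :
    cochainMatrix K b (g * h) = cochainMatrix K b g * cochainMatrix K b h := by
  refine unitriangular_ext fun i j hij => ?_
  have e : b i j h - b i j (g * h) + b i j g = ∑ l ∈ Finset.Ioo (i : ℕ) j, b i l g * b l j h := by
    have := congrArg (fun c => c (g, h)) (hb i j hij j.2)
    simp only [ContinuousMap.sum_apply] at this
    exact this
  change _ = ((cochainMatrix K b g).1 * (cochainMatrix K b h).1) i j
  rw [unitriangular_mul_apply (cochainMatrix K b g).2 (cochainMatrix K b h).2 hij,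
    cochainMatrix_apply b _ hij, cochainMatrix_apply b _ hij, cochainMatrix_apply b _ hij]
  rw [← sum_Ioo_val i j fun l => b i l g * b l j h] at e
  rw [Finset.sum_congr rfl fun l hl => by
    rw [cochainMatrix_apply b g (Finset.mem_Ioo.1 hl).1,
      cochainMatrix_apply b h (Finset.mem_Ioo.1 hl).2, neg_mul_neg], ← e]
  ring

/-- The unitriangular representation with entries `-b i j` attached to a family of cochains with
`∂ (b i j) = ∑ b i l ∪ b l j`. -/
def cochainRep (b : ℕ → ℕ → C(G, ZMod p)) (hb : ∀ i j, i < j → j < K →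
    d1 p G (b i j) = ∑ l ∈ Finset.Ioo i j, cup (b i l) (b l j)) : G →ₜ* unitriangular p K where
  toMonoidHom := MonoidHom.mk' (cochainMatrix K b) (cochainMatrix_mul hb)
  continuous_toFun := by
    refine Continuous.subtype_mk (continuous_matrix fun i j => ?_) _
    simp only [Matrix.of_apply]
    split_ifs <;> fun_prop

theorem cochainRep_apply {b : ℕ → ℕ → C(G, ZMod p)} {hb : ∀ i j, i < j → j < K →
    d1 p G (b i j) = ∑ l ∈ Finset.Ioo i j, cup (b i l) (b l j)} (g : G) {i j : Fin K}
    (h : i < j) : (cochainRep b hb g).1 i j = -(b i j g) :=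
  cochainMatrix_apply b g h

end CochainRep

/-! ### Entries of a representation as cochains -/

section Entry

variable {p K : ℕ} [Fact p.Prime] {F : Type*} [Group F] [TopologicalSpace F]

/-- The entries of a unitriangular representation. -/
def entry (ρ : F →ₜ* unitriangular p K) (i j : ℕ) : C(F, ZMod p) where
  toFun f := if h : i < K ∧ j < K then (ρ f).1 ⟨i, h.1⟩ ⟨j, h.2⟩ else 0
  continuous_toFun := by
    split_ifs with h
    · exact ((continuous_subtype_val.comp ρ.continuous_toFun).matrix_elem _ _)
    · exact continuous_const

theorem entry_val (ρ : F →ₜ* unitriangular p K) (i j : Fin K) (f : F) :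
    entry ρ i j f = (ρ f).1 i j :=
  dif_pos ⟨i.2, j.2⟩

theorem entry_mul (ρ : F →ₜ* unitriangular p K) {i j : ℕ} (hij : i < j) (hj : j < K) (f g : F) :
    entry ρ i j (f * g) = entry ρ i j f + entry ρ i j g +
      ∑ l ∈ Finset.Ioo i j, entry ρ i l f * entry ρ l j g := by
  lift i to Fin K using hij.trans hj
  lift j to Fin K using hj
  rw [← sum_Ioo_val, entry_val, entry_val, entry_val, map_mul]
  simp only [entry_val]
  exact unitriangular_mul_apply (ρ f).2 (ρ g).2 hij

/-- Only the entries of `r` in column `j`, from row `i` on, affect this entry of `f * r`. The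
invariance is what lets entries descend to `F/R`. -/
theorem entry_mul_of_forall_eq_zero (ρ : F →ₜ* unitriangular p K) {i j : ℕ} (hij : i < j)
    (hj : j < K) {r : F} (hr : ∀ l, i ≤ l → l < j → entry ρ l j r = 0) (f : F) :
    entry ρ i j (f * r) = entry ρ i j f := by
  rw [entry_mul ρ hij hj, hr i le_rfl hij, add_zero, add_eq_left]
  refine Finset.sum_eq_zero fun l hl => ?_
  rw [Finset.mem_Ioo] at hl
  rw [hr l hl.1.le hl.2, mul_zero]

theorem eq_one_of_entry {ρ : F →ₜ* unitriangular p K} {f : F}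
    (h : ∀ i j, i < j → j < K → entry ρ i j f = 0) : ρ f = 1 := by
  refine unitriangular_ext fun i j hij => ?_
  rw [← entry_val, h i j hij j.2]
  exact (Matrix.one_apply_ne hij.ne).symm

theorem entry_eq_zero {ρ : F →ₜ* unitriangular p K} {f : F} (hf : ρ f = 1) {i j : ℕ}
    (hij : i < j) (hj : j < K) : entry ρ i j f = 0 := by
  lift i to Fin K using hij.trans hj
  lift j to Fin K using hj
  rw [entry_val, hf]
  exact Matrix.one_apply_ne (fun h => hij.ne (congrArg _ h))

theorem entry_compMinorLeft (ρ : F →ₜ* unitriangular p (K + 1)) {i j : ℕ} (hi : i < K)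
    (hj : j < K) (f : F) : entry (compMinorLeft ρ) i j f = entry ρ i j f := by
  lift i to Fin K using hi
  lift j to Fin K using hj
  rw [entry_val]
  exact (entry_val ρ i.castSucc j.castSucc f).symm

theorem entry_compMinorRight (ρ : F →ₜ* unitriangular p (K + 1)) {i j : ℕ} (hi : i < K)
    (hj : j < K) (f : F) : entry (compMinorRight ρ) i j f = entry ρ (i + 1) (j + 1) f := by
  lift i to Fin K using hi
  lift j to Fin K using hj
  rw [entry_val]
  exact (entry_val ρ i.succ j.succ f).symm

/-- Outside the upper right corner, the entries of a representation are entries of its minors. -/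
theorem entry_eq_zero_of_minors {k : ℕ} {ρ : F →ₜ* unitriangular p (k + 1)} {f : F}
    (hl : compMinorLeft ρ f = 1) (hr : compMinorRight ρ f = 1) {i j : ℕ} (hij : i < j)
    (hj : j ≤ k) (hc : (i, j) ≠ (0, k)) : entry ρ i j f = 0 := by
  rcases hj.lt_or_eq with h | rfl
  · rw [← entry_compMinorLeft ρ (by omega) h]
    exact entry_eq_zero hl hij h
  · obtain ⟨i, rfl⟩ : ∃ m, i = m + 1 :=
      ⟨i - 1, by have : i ≠ 0 := by rintro rfl; exact hc rfl
                 omega⟩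
    obtain ⟨j, rfl⟩ : ∃ m, j = m + 1 := ⟨j - 1, by omega⟩
    rw [← entry_compMinorRight ρ (by omega) (by omega)]
    exact entry_eq_zero hr (by omega) (by omega)

end Entry

/-! ### Passing between representations of `F` and cochains on `F/R` -/

section Descend

variable {p : ℕ} [Fact p.Prime] {F : Type*} [Group F] [TopologicalSpace F] (R : Subgroup F)

open Classical in
/-- The cochain on `F/R` induced by an `R`-invariant cochain on `F` (and `0` otherwise). -/
noncomputable def descend (φ : C(F, ZMod p)) : C(F ⧸ R, ZMod p) :=
  if h : ∀ f, ∀ r ∈ R, φ (f * r) = φ f then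
    ⟨fun q => φ q.out, by
      refine (QuotientGroup.isQuotientMap_mk (N := R)).continuous_iff.2 ?_
      refine φ.continuous.congr fun f => ?_
      obtain ⟨r, hr⟩ := QuotientGroup.mk_out_eq_mul R f
      change φ f = φ (Quotient.out (f : F ⧸ R))
      rw [hr, h f r r.2]⟩
  else 0

theorem descend_mk {φ : C(F, ZMod p)} (h : ∀ f, ∀ r ∈ R, φ (f * r) = φ f) (f : F) :
    descend R φ (f : F ⧸ R) = φ f := by
  rw [descend, dif_pos h]
  obtain ⟨r, hr⟩ := QuotientGroup.mk_out_eq_mul R f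
  change φ (Quotient.out (f : F ⧸ R)) = φ f
  rw [hr, h f r r.2]

variable {K k : ℕ}

theorem descend_entry_mk {ρ : F →ₜ* unitriangular p K} {i j : ℕ} (hij : i < j)
    (hj : j < K) (hr : ∀ r ∈ R, ∀ l, i ≤ l → l < j → entry ρ l j r = 0) (f : F) :
    descend R (-entry ρ i j) (f : F ⧸ R) = -entry ρ i j f :=
  descend_mk R (fun f r h => congrArg Neg.neg (entry_mul_of_forall_eq_zero ρ hij hj (hr r h) f)) f

variable [IsTopologicalGroup F] [R.Normal]

/-- The projection `F → F/R` as a continuous homomorphism. -/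
def mkHom : F →ₜ* F ⧸ R where
  toMonoidHom := QuotientGroup.mk' R
  continuous_toFun := QuotientGroup.continuous_mk

theorem d1_eq_of_entry {ρ : F →ₜ* unitriangular p K} {i j : ℕ} (hij : i < j)
    (hj : j < K) {b : ℕ → ℕ → C(F ⧸ R, ZMod p)} {c : C(F ⧸ R, ZMod p)}
    (hc : ∀ f : F, c (f : F ⧸ R) = -entry ρ i j f)
    (hl : ∀ l ∈ Finset.Ioo i j, ∀ f : F, b i l (f : F ⧸ R) = -entry ρ i l f)
    (hr : ∀ l ∈ Finset.Ioo i j, ∀ f : F, b l j (f : F ⧸ R) = -entry ρ l j f) :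
    d1 p (F ⧸ R) c = ∑ l ∈ Finset.Ioo i j, cup (b i l) (b l j) := by
  refine ContinuousMap.ext fun ⟨g, h⟩ => ?_
  obtain ⟨g, rfl⟩ := QuotientGroup.mk_surjective g
  obtain ⟨h, rfl⟩ := QuotientGroup.mk_surjective h
  rw [ContinuousMap.sum_apply]
  change c (h : F ⧸ R) - c ((g * h : F) : F ⧸ R) + c (g : F ⧸ R) =
    ∑ l ∈ Finset.Ioo i j, b i l (g : F ⧸ R) * b l j (h : F ⧸ R)
  have hs : ∀ l ∈ Finset.Ioo i j, b i l (g : F ⧸ R) * b l j (h : F ⧸ R) =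
      entry ρ i l g * entry ρ l j h := fun l hm => by rw [hl l hm, hr l hm, neg_mul_neg]
  rw [hc, hc, hc, entry_mul ρ hij hj, Finset.sum_congr rfl hs]
  ring

/-- A unitriangular representation of `F` whose restriction to `R` is trivial outside the corner
defines a defining system on `F/R`. -/
theorem exists_isDefiningSystem (hk : 2 ≤ k) {ρ : F →ₜ* unitriangular p (k + 1)}
    (hR : ∀ r ∈ R, ∀ i j, i < j → j ≤ k → (i, j) ≠ (0, k) → entry ρ i j r = 0) :
    ∃ (χ : Fin k → H1 p (F ⧸ R)) (a : ℕ → ℕ → C(F ⧸ R, ZMod p)), IsDefiningSystem χ a ∧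
      ∀ (i : Fin k) (f : F), (χ i).1 (f : F ⧸ R) = -entry ρ i (i + 1) f := by
  have hmk : ∀ i j, i < j → j ≤ k → (i, j) ≠ (0, k) → ∀ f : F,
      descend R (-entry ρ i j) (f : F ⧸ R) = -entry ρ i j f := by
    intro i j hij hj hc f
    refine descend_entry_mk R hij (by omega) (fun r hr l hl hl' => hR r hr l j hl' hj ?_) f
    rw [Ne, Prod.mk_inj] at hc ⊢
    omega
  have hd : ∀ i j, i < j → j ≤ k → (i, j) ≠ (0, k) → d1 p (F ⧸ R) (descend R (-entry ρ i j)) =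
      ∑ l ∈ Finset.Ioo i j,
        cup (descend R (-entry ρ i l)) (descend R (-entry ρ l j)) := by
    intro i j hij hj hc
    refine d1_eq_of_entry R (b := fun i j => descend R (-entry ρ i j)) hij (by omega)
      (hmk i j hij hj hc) (fun l hl => ?_) (fun l hl => ?_) <;>
    · rw [Finset.mem_Ioo] at hl
      refine hmk _ _ (by omega) (by omega) ?_
      rw [Ne, Prod.mk_inj] at hc ⊢
      omega
  -- As `k ≥ 2`, no superdiagonal position is the corner.
  have hne : ∀ i : Fin k, ((i : ℕ), (i : ℕ) + 1) ≠ (0, k) := by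
    intro i h
    rw [Prod.mk_inj] at h
    omega
  refine ⟨fun i => ⟨descend R (-entry ρ i (i + 1)), ?_⟩, fun i j => descend R (-entry ρ i j),
    ⟨fun i => rfl, hd⟩, fun i => hmk _ _ (Nat.lt_succ_self i) i.2 (hne i)⟩
  rw [AddMonoidHom.mem_ker, hd _ _ (Nat.lt_succ_self i) i.2 (hne i)]
  refine Finset.sum_eq_zero fun l hl => ?_
  rw [Finset.mem_Ioo] at hl
  omega

/-- A Massey product on `F/R` vanishes only if its characters form the superdiagonal of a
unitriangular representation of `F` that is trivial on `R`. -/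
theorem exists_rep_of_vanishes (hk : 2 ≤ k) {χ : Fin k → H1 p (F ⧸ R)} (h : Vanishes χ) :
    ∃ ρ : F →ₜ* unitriangular p (k + 1), (∀ r ∈ R, ρ r = 1) ∧
      ∀ (i : Fin k) (f : F), (ρ f).1 i.castSucc i.succ = -(χ i).1 (f : F ⧸ R) := by
  obtain ⟨a, ha, h0⟩ := h
  obtain ⟨b, hb⟩ := (mk_eq_zero_iff _).1 h0.symm
  -- A cochain bounding the Massey cocycle is exactly the missing corner.
  set a' : ℕ → ℕ → C(F ⧸ R, ZMod p) := fun i j => if (i, j) = (0, k) then b else a i j with ha'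
  have hne : ∀ i j, (i, j) ≠ (0, k) → a' i j = a i j := fun i j h => if_neg h
  have hd : ∀ i j, i < j → j < k + 1 →
      d1 p (F ⧸ R) (a' i j) = ∑ l ∈ Finset.Ioo i j, cup (a' i l) (a' l j) := by
    intro i j hij hj
    have hs : ∑ l ∈ Finset.Ioo i j, cup (a' i l) (a' l j) =
        ∑ l ∈ Finset.Ioo i j, cup (a i l) (a l j) := by
      refine Finset.sum_congr rfl fun l hl => ?_
      rw [Finset.mem_Ioo] at hl
      rw [hne, hne] <;>
      · rw [Ne, Prod.mk_inj]
        omega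
    rw [hs]
    by_cases hc : (i, j) = (0, k)
    · obtain ⟨rfl, rfl⟩ := Prod.mk_inj.1 hc
      exact (congrArg _ (if_pos rfl)).trans hb
    · rw [hne i j hc]
      exact ha.coboundary i j hij (by omega) hc
  refine ⟨(cochainRep a' hd).comp (mkHom R), fun r hr => ?_, fun i f => ?_⟩
  · change cochainRep a' hd (r : F ⧸ R) = 1
    rw [(QuotientGroup.eq_one_iff r).2 hr, map_one]
  · refine (cochainRep_apply (hb := hd) (f : F ⧸ R) (Fin.castSucc_lt_succ)).trans ?_
    rw [← ha.diag i, ← hne]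
    · rfl
    · rw [Ne, Prod.mk_inj]
      omega

end Descend

/-! ### Massey products and the position of `R` in the filtration -/

section Vanishing

variable {p : ℕ} {F : Type*} [Group F] [TopologicalSpace F]

theorem H1_mul {G : Type*} [Group G] [TopologicalSpace G] [IsTopologicalGroup G] (χ : H1 p G)
    (g h : G) : χ.1 (g * h) = χ.1 g + χ.1 h := by
  have e : χ.1 h - χ.1 (g * h) + χ.1 g = 0 :=
    congrArg (fun c : C(G × G, ZMod p) => c (g, h)) (AddMonoidHom.mem_ker.1 χ.2)
  linear_combination -e

theorem zassenhaus_anti {m n : ℕ} (h : m ≤ n) : zassenhaus p F n ≤ zassenhaus p F m :=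
  fun _ hf N => Ideal.pow_le_pow_right h (hf N)

variable [Fact p.Prime] [IsTopologicalGroup F] {d : ℕ} {x : Fin d → F} {R : Subgroup F} [R.Normal]
  {k : ℕ}

/-- A defining system on `F/R` lifts, outside the upper right corner, to a unitriangular
representation of the free pro-`p` group `F`. -/
theorem IsDefiningSystem.exists_rep (hF : IsFreeProP p x) {χ : Fin k → H1 p (F ⧸ R)}
    {a : ℕ → ℕ → C(F ⧸ R, ZMod p)} (ha : IsDefiningSystem χ a) :
    ∃ ρ : F →ₜ* unitriangular p (k + 1), ∀ i j, i < j → j ≤ k → (i, j) ≠ (0, k) →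
      ∀ f : F, entry ρ i j f = -a i j (f : F ⧸ R) := by
  set a' : ℕ → ℕ → C(F ⧸ R, ZMod p) := fun i j => if (i, j) = (0, k) then 0 else a i j with ha'
  have hne : ∀ i j, (i, j) ≠ (0, k) → a' i j = a i j := fun i j h => if_neg h
  obtain ⟨ρ, hρ⟩ := hF.exists_rep (p := p) fun t => cochainMatrix (k + 1) a' (x t : F ⧸ R)
  have hl : ∀ i j, i < j → j < k →
      d1 p (F ⧸ R) (a i j) = ∑ l ∈ Finset.Ioo i j, cup (a i l) (a l j) := by
    intro i j hij hj
    refine ha.coboundary i j hij hj.le ?_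
    rw [Ne, Prod.mk_inj]
    omega
  have hr : ∀ i j, i < j → j < k → d1 p (F ⧸ R) (a (i + 1) (j + 1)) =
      ∑ l ∈ Finset.Ioo i j, cup (a (i + 1) (l + 1)) (a (l + 1) (j + 1)) := by
    intro i j hij hj
    rw [ha.coboundary (i + 1) (j + 1) (by omega) (by omega) (by simp),
      ← Finset.map_add_right_Ioo, Finset.sum_map]
    rfl
  -- Neither minor sees the corner, so each is compared on generators with an honest representation
  -- of `F/R`. The corner value `0` in `a'` is arbitrary.
  have el : compMinorLeft ρ = (cochainRep a hl).comp (mkHom R) := by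
    refine hF.rep_ext fun t => unitriangular_ext fun i j hij => ?_
    change (ρ (x t)).1 i.castSucc j.castSucc = (cochainRep a hl (x t : F ⧸ R)).1 i j
    rw [hρ, cochainRep_apply _ hij, cochainMatrix_apply _ _ (Fin.castSucc_lt_castSucc_iff.2 hij),
      hne]
    · rfl
    · rw [Ne, Prod.mk_inj, Fin.val_castSucc, Fin.val_castSucc]
      omega
  have er : compMinorRight ρ =
      (cochainRep (fun i j => a (i + 1) (j + 1)) hr).comp (mkHom R) := by
    refine hF.rep_ext fun t => unitriangular_ext fun i j hij => ?_
    change (ρ (x t)).1 i.succ j.succ =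
      (cochainRep (fun i j => a (i + 1) (j + 1)) hr (x t : F ⧸ R)).1 i j
    rw [hρ, cochainRep_apply _ hij, cochainMatrix_apply _ _ (Fin.succ_lt_succ_iff.2 hij), hne]
    · rfl
    · rw [Ne, Prod.mk_inj, Fin.val_succ]
      omega
  refine ⟨ρ, fun i j hij hj hc f => ?_⟩
  rcases hj.lt_or_eq with h | h
  · rw [← entry_compMinorLeft ρ (by omega) h, el]
    lift i to Fin k using hij.trans h
    lift j to Fin k using h
    rw [entry_val]
    exact cochainRep_apply (hb := hl) (f : F ⧸ R) hij
  · have hi : i ≠ 0 := fun h0 => hc (Prod.mk_inj.2 ⟨h0, h⟩)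
    obtain ⟨i, rfl⟩ := Nat.exists_eq_succ_of_ne_zero hi
    obtain ⟨j, rfl⟩ := Nat.exists_eq_succ_of_ne_zero (n := j) (by omega)
    have hj' : j < k := hj
    rw [Nat.succ_eq_add_one, Nat.succ_eq_add_one,
      ← entry_compMinorRight ρ (by omega) hj', er]
    lift i to Fin k using by omega
    lift j to Fin k using hj'
    rw [entry_val]
    exact cochainRep_apply (hb := hr) (f : F ⧸ R) (by omega : i < j)

/-- If `R ⊆ F_(k+1)`, then every defining system on `F/R` gives the zero class. -/
theorem IsDefiningSystem.exists_d1_eq (hF : IsFreeProP p x) (hR : R ≤ zassenhaus p F (k + 1))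
    (hk : 2 ≤ k) {χ : Fin k → H1 p (F ⧸ R)} {a : ℕ → ℕ → C(F ⧸ R, ZMod p)}
    (ha : IsDefiningSystem χ a) : ∃ b, d1 p (F ⧸ R) b = masseyCochain k a := by
  obtain ⟨ρ, hρ⟩ := ha.exists_rep hF
  have hmk : ∀ l, 0 < l → l < k →
      (∀ f : F, a 0 l (f : F ⧸ R) = -entry ρ 0 l f) ∧
        ∀ f : F, a l k (f : F ⧸ R) = -entry ρ l k f := by
    intro l h0 hl
    constructor <;> intro f <;> rw [hρ _ _ (by omega) (by omega)
      (by rw [Ne, Prod.mk_inj]; omega), neg_neg]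
  -- `ρ` kills `R`, so its corner descends and bounds the Massey cocycle.
  refine ⟨descend R (-entry ρ 0 k), d1_eq_of_entry R (ρ := ρ) (by omega) (by omega) ?_ ?_ ?_⟩
  · exact descend_entry_mk R (by omega) (by omega) fun r hr l _ hl =>
      entry_eq_zero (map_eq_one_of_mem_zassenhaus (hR hr) ρ) hl (by omega)
  · intro l hl
    rw [Finset.mem_Ioo] at hl
    exact (hmk l hl.1 hl.2).1
  · intro l hl
    rw [Finset.mem_Ioo] at hl
    exact (hmk l hl.1 hl.2).2

/-- Freeness realizes the given characters as a superdiagonal on the generators, and the resulting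
representation kills `R`. -/
theorem isDefined_of_le_zassenhaus (hF : IsFreeProP p x) (hR : R ≤ zassenhaus p F (k + 1))
    (hk : 2 ≤ k) (χ : Fin k → H1 p (F ⧸ R)) : IsDefined χ := by
  obtain ⟨ρ, hρ⟩ := hF.exists_rep_superdiag fun t (i : Fin k) => -(χ i).1 (x t : F ⧸ R)
  obtain ⟨χ', a, ha, hχ'⟩ := exists_isDefiningSystem R hk (ρ := ρ) fun r hr i j hij hj _ =>
    entry_eq_zero (map_eq_one_of_mem_zassenhaus (hR hr) ρ) hij (by omega)
  have e : χ' = χ := by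
    refine funext fun i => Subtype.ext (ContinuousMap.ext fun g => ?_)
    obtain ⟨f, rfl⟩ := QuotientGroup.mk_surjective g
    refine sub_eq_zero.1 (hF.hom_eq_zero
      (fun f => (χ' i).1 (f : F ⧸ R) - (χ i).1 (f : F ⧸ R)) ?_ (fun f g => ?_) (fun t => ?_) f)
    · have := QuotientGroup.continuous_mk (N := R)
      fun_prop
    · rw [QuotientGroup.mk_mul, H1_mul, H1_mul, add_sub_add_comm]
    · rw [hχ', sub_eq_zero, neg_eq_iff_eq_neg]
      refine (entry_val ρ i.castSucc i.succ (x t)).trans ?_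
      rw [hρ, Matrix.add_apply, Matrix.one_apply_ne (Fin.castSucc_lt_succ).ne, zero_add,
        superdiag_apply, dif_pos (by simp)]
      rfl
  subst e
  exact ⟨_, a, ha, rfl⟩

theorem massey_eq_zero_of_le_zassenhaus (hF : IsFreeProP p x) (hR : R ≤ zassenhaus p F (k + 1))
    (hk : 2 ≤ k) (χ : Fin k → H1 p (F ⧸ R)) : massey χ = {0} := by
  refine (isDefined_of_le_zassenhaus hF hR hk χ).subset_singleton_iff.1 ?_
  rintro c ⟨a, ha, rfl⟩
  exact (mk_eq_zero_iff _).2 (ha.exists_d1_eq hF hR hk)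

/-- The entry `a i (i + 2)` bounds the cup product; `3 ≤ k` keeps it away from the corner. -/
theorem IsDefined.cupH_eq_zero {G : Type*} [Group G] [TopologicalSpace G] [IsTopologicalGroup G]
    (hk : 3 ≤ k) {χ : Fin k → H1 p G} (h : IsDefined χ) (i : ℕ) (hi : i + 1 < k) :
    cupH (χ ⟨i, by omega⟩) (χ ⟨i + 1, hi⟩) = 0 := by
  obtain ⟨_, a, ha, _⟩ := h
  refine (mk_eq_zero_iff _).2 ⟨a i (i + 2), ?_⟩
  rw [ha.coboundary i (i + 2) (by omega) (by omega) (by rw [Ne, Prod.mk_inj]; omega)]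
  have e : Finset.Ioo i (i + 2) = {i + 1} := by
    ext l
    rw [Finset.mem_Ioo, Finset.mem_singleton]
    omega
  rw [e, Finset.sum_singleton]
  exact congrArg₂ cup (ha.diag ⟨i, by omega⟩) (ha.diag ⟨i + 1, hi⟩)

/-- Representations of size `2` are continuous homomorphisms to `ℤ/p`, which kill `p`-th powers,
commutators and their closure. -/
theorem powerCommutatorSubgroup_le_zassenhaus (hF : IsFreeProP p x) :
    powerCommutatorSubgroup p F ≤ zassenhaus p F 2 := by
  intro f hf
  refine hF.mem_zassenhaus_succ (fun N => ?_) fun ρ => eq_one_of_entry fun i j hij hj => ?_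
  · rw [Submodule.pow_one]
    exact of_sub_one_mem _
  obtain rfl : i = 0 := by omega
  obtain rfl : j = 1 := by omega
  let ψ : F →* Multiplicative (ZMod p) :=
    MonoidHom.mk' (fun f => Multiplicative.ofAdd (entry ρ 0 1 f)) fun f g => by
      rw [entry_mul ρ hij hj, show Finset.Ioo 0 1 = ∅ from rfl, Finset.sum_empty, add_zero,
        ofAdd_add]
  have hψ : Continuous ψ := continuous_ofAdd.comp (entry ρ 0 1).continuous
  have hle : powerCommutatorSubgroup p F ≤ ψ.ker := by
    refine Subgroup.topologicalClosure_minimal _ (sup_le ?_ (Abelianization.commutator_subset_ker ψ))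
      ((isClosed_singleton (x := 1)).preimage hψ)
    rw [Subgroup.closure_le]
    rintro _ ⟨g, rfl⟩
    rw [SetLike.mem_coe, MonoidHom.mem_ker, map_pow]
    exact Multiplicative.toAdd.injective (by simp)
  exact congrArg Multiplicative.toAdd (hle hf)

/-- The inductive step: if `R ⊆ F_(k)` and `F/R` has the `k`-fold Massey vanishing property, then
`R ⊆ F_(k+1)`. -/
theorem le_zassenhaus_succ (hF : IsFreeProP p x) (hk : 2 ≤ k) (hR : R ≤ zassenhaus p F k)
    (hM : MasseyVanishingProperty p (F ⧸ R) k) : R ≤ zassenhaus p F (k + 1) := by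
  refine fun r hr => hF.mem_zassenhaus_succ (hR hr) fun ρ => ?_
  -- The minors have size `k`, so they kill `R ⊆ F_(k)`; only the corner of `ρ` can survive on `R`.
  obtain ⟨χ, a, ha, hχ⟩ := exists_isDefiningSystem R hk (ρ := ρ) fun s hs i j hij hj hc =>
    entry_eq_zero_of_minors (map_eq_one_of_mem_zassenhaus (hR hs) _)
      (map_eq_one_of_mem_zassenhaus (hR hs) _) hij hj hc
  obtain ⟨ρ', hρ', hχ'⟩ := exists_rep_of_vanishes R hk (hM χ ⟨_, a, ha, rfl⟩)
  rw [← hρ' r hr]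
  refine map_eq_map_of_mem_zassenhaus (hR hr) ρ ρ' fun f i => ?_
  rw [hχ', hχ, neg_neg]
  exact (entry_val ρ i.castSucc i.succ f).symm

end Vanishing

end ProPMassey

/-! ### The equivalence -/

theorem mainTheorem7 (p : ℕ) [Fact p.Prime]
    {F : Type*} [Group F] [TopologicalSpace F] [IsTopologicalGroup F]
    (d : ℕ) (x : Fin d → F) (hF : ProPMassey.IsFreeProP p x)
    (R : Subgroup F) [R.Normal] (hRclosed : IsClosed (R : Set F))
    (hR : R ≤ ProPMassey.powerCommutatorSubgroup p F)
    (n : ℕ) (hn : 2 ≤ n) :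
    List.TFAE [
      R ≤ ProPMassey.zassenhaus p F (n + 1),
      ∀ k, 2 ≤ k → k ≤ n → ∀ χ : Fin k → ProPMassey.H1 p (F ⧸ R),
        ProPMassey.IsStrictlyDefined χ ∧ ProPMassey.IsUniquelyDefined χ ∧
          ProPMassey.massey χ = {0},
      ∀ k, 2 ≤ k → k ≤ n → ProPMassey.StrongMasseyVanishingProperty p (F ⧸ R) k,
      ∀ k, 2 ≤ k → k ≤ n → ProPMassey.MasseyVanishingProperty p (F ⧸ R) k] := by
  tfae_have 1 → 2 := by
    intro h
    have key : ∀ k, 2 ≤ k → k ≤ n → ∀ χ : Fin k → ProPMassey.H1 p (F ⧸ R),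
        ProPMassey.massey χ = {0} := fun k hk hkn χ =>
      ProPMassey.massey_eq_zero_of_le_zassenhaus hF
        (h.trans (ProPMassey.zassenhaus_anti (by omega))) hk χ
    intro k hk hkn χ
    have hχ := key k hk hkn χ
    refine ⟨⟨?_, fun i m _ hm hmk => key m hm (by omega) _⟩, ?_, hχ⟩
    · rw [ProPMassey.IsDefined, hχ]
      exact Set.singleton_nonempty 0
    · rw [ProPMassey.IsUniquelyDefined, hχ]
      exact ⟨0, rfl, fun _ hc => hc⟩
  tfae_have 2 → 3 := by
    intro h k hk hkn χ _
    rw [ProPMassey.Vanishes, (h k hk hkn χ).2.2]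
    rfl
  tfae_have 3 → 4 := fun h k hk hkn χ hχ =>
    h k hk hkn χ fun hk3 i hi => hχ.cupH_eq_zero hk3 i hi
  tfae_have 4 → 1 := by
    intro h
    -- The induction starts at `F_(2)`, given by `R ⊆ F^p[F, F]`; the `k`-fold property then raises
    -- `F_(k)` to `F_(k+1)`.
    have key : ∀ k, 1 ≤ k → k ≤ n → R ≤ ProPMassey.zassenhaus p F (k + 1) := by
      intro k hk
      induction k, hk using Nat.le_induction with
      | base => exact fun _ => hR.trans (ProPMassey.powerCommutatorSubgroup_le_zassenhaus hF)
      | succ k hk ih =>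
        exact fun hkn => ProPMassey.le_zassenhaus_succ hF (by omega) (ih (by omega))
          (h (k + 1) (by omega) hkn)
    exact key n (by omega) le_rfl
  tfae_finish
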